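/- Let $1<p\le 2$, let $n,d\in\mathbb N$ with $d\ge 1$, and let $L^p(\mathbb R^d)$ be the space of real- or complex-valued $p$-integrable functions with respect to Lebesgue measure. For $\gamma\in\mathbb R^d$ put $(T_\gamma f)(x)=f(x-\gamma)$. A family $(x_i)_{i\in I}$ in a Banach space $X$ is called an unconditional basis of $X$ if for every $x\in X$ there is a unique family of scalars $(a_i)_{i\in I}$ such that $x=\sum_{i\in I}a_ix_i$ with unconditional convergence. For each $k=1,\dots,n$ let $f_k\in L^p(\mathbb R^d)$ be nonzero and let $\Gamma_k$ be an arbitrary family of points of $\mathbb R^d$. Consider the disjoint union $\bigcup_{k=1}^n\{T_\gamma f_k\}_{\gamma\in\Gamma_k}$, i.e. the family indexed by the disjoint union of (the index sets of) $\Gamma_1,\dots,\Gamma_n$. If this system is an unconditional basis of a closed subspace $M$ of $L^p(\mathbb R^d)$, then $M\ne L^p(\mathbb R^d)$. Equivalently, $\bigcup_{k=1}^n\{T_\gamma f_k\}_{\gamma\in\Gamma_k}$ is not an unconditional basis of $L^p(\mathbb R^d)$. -/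

import Mathlib

open MeasureTheory
open scoped ENNReal

/-- A family `e` in a normed space `X` is an unconditional basis of `X` if every `x : X` has a
unique family of scalars `a` such that `∑ i, a i • e i` converges unconditionally to `x`
(`HasSum` is convergence of the net of finite partial sums, hence independent of any ordering). -/
def IsUnconditionalBasis (𝕜 : Type*) {X ι : Type*} [RCLike 𝕜] [NormedAddCommGroup X]
    [NormedSpace 𝕜 X] (e : ι → X) : Prop :=
  ∀ x : X, ∃! a : ι → 𝕜, HasSum (fun i => a i • e i) x

/-- The family `e` lies in the subspace `M` and is an unconditional basis of `M`. -/
def IsUnconditionalBasisOf {𝕜 X ι : Type*} [RCLike 𝕜] [NormedAddCommGroup X]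
    [NormedSpace 𝕜 X] (M : Submodule 𝕜 X) (e : ι → X) : Prop :=
  ∃ h : ∀ i, e i ∈ M, IsUnconditionalBasis 𝕜 (fun i => (⟨e i, h i⟩ : M))

/-- The translation operator on `L^p(ℝ^d)`: `(T_γ f)(x) = f (x - γ)`. -/
noncomputable def lpTranslate {𝕜 : Type*} [RCLike 𝕜] {d : ℕ} {p : ℝ≥0∞}
    (γ : EuclideanSpace ℝ (Fin d))
    (f : Lp 𝕜 p (volume : Measure (EuclideanSpace ℝ (Fin d)))) :
    Lp 𝕜 p (volume : Measure (EuclideanSpace ℝ (Fin d))) :=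
  Lp.compMeasurePreserving (fun x => x - γ) (measurePreserving_sub_right volume γ) f

theorem coeFn_lpTranslate {𝕜 : Type*} [RCLike 𝕜] {d : ℕ} {p : ℝ≥0∞}
    (γ : EuclideanSpace ℝ (Fin d))
    (f : Lp 𝕜 p (volume : Measure (EuclideanSpace ℝ (Fin d)))) :
    lpTranslate γ f =ᵐ[volume] fun x => f (x - γ) :=
  Lp.coeFn_compMeasurePreserving f (measurePreserving_sub_right volume γ)

/-- The disjoint union over `k` of the systems `{T_γ (f k)}`, `γ` running through the family
`Γ k`, as a family indexed by the disjoint union of the index sets. -/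
noncomputable def translateSystem {𝕜 : Type*} [RCLike 𝕜] {d n : ℕ} {p : ℝ≥0∞}
    (f : Fin n → Lp 𝕜 p (volume : Measure (EuclideanSpace ℝ (Fin d))))
    {ι : Fin n → Type*} (Γ : ∀ k, ι k → EuclideanSpace ℝ (Fin d)) :
    (Σ k, ι k) → Lp 𝕜 p (volume : Measure (EuclideanSpace ℝ (Fin d))) :=
  fun i => lpTranslate (Γ i.1 i.2) (f i.1)

/-! ### Unconditional bases and uniform bounds for their partial sums. -/

section UnconditionalBasis

variable {𝕜 X ι : Type*} [RCLike 𝕜] [NormedAddCommGroup X] [NormedSpace 𝕜 X] {e : ι → X}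

/-! Suppose the translates form an unconditional basis. The closed graph theorem bounds all partial
sums by `K * ‖x‖` (`IsUnconditionalBasis.exists_norm_sum_le`), so distinct translates of one `f k`
stay apart in norm and each `Γ k` is δ-separated. Averaging over partial sums and integrating over
disjoint balls puts all coefficient families in ℓ^p
(`IsUnconditionalBasis.exists_sum_enorm_coeff_rpow_le`). Separation also makes the restrictions of
the basis elements to a ball of radius δ/2 p-summable (`sum_enorm_restrict_ball_rpow_le`). Since p ≤
2, both families are in ℓ², and Cauchy–Schwarz gives restriction norm at most 1/2 on the common
kernel of finitely many coefficient functionals (`exists_finset_norm_le_half`). That kernel contains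
a nonzero function supported in the ball, whose norm restriction preserves: a contradiction. -/

theorem bddAbove_norm_sum_of_summable {E ι : Type*} [NormedAddCommGroup E] {u : ι → E}
    (hu : Summable u) : BddAbove (Set.range fun A : Finset ι => ‖∑ i ∈ A, u i‖) := by
  classical
  obtain ⟨s, hs⟩ := hu.vanishing (Metric.ball_mem_nhds 0 one_pos)
  refine ⟨∑ i ∈ s, ‖u i‖ + 1, ?_⟩
  rintro _ ⟨A, rfl⟩
  have h1 : ∑ i ∈ A, u i = ∑ i ∈ A ∩ s, u i + ∑ i ∈ A \ s, u i :=
    (Finset.sum_inter_add_sum_sdiff A s u).symm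
  have h2 : ‖∑ i ∈ A ∩ s, u i‖ ≤ ∑ i ∈ s, ‖u i‖ :=
    (norm_sum_le _ _).trans
      (Finset.sum_le_sum_of_subset_of_nonneg Finset.inter_subset_right fun _ _ _ => norm_nonneg _)
  have h3 := hs (A \ s) Finset.sdiff_disjoint
  rw [mem_ball_zero_iff] at h3
  simp only [h1]
  linarith [norm_add_le (∑ i ∈ A ∩ s, u i) (∑ i ∈ A \ s, u i)]

theorem hasSum_single_smul (e : ι → X) [DecidableEq ι] (i : ι) :
    HasSum (fun j => (Pi.single i 1 : ι → 𝕜) j • e j) (e i) := by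
  convert hasSum_single (f := fun j => (Pi.single i 1 : ι → 𝕜) j • e j) i ?_ using 1
  · simp
  · intro j hj
    simp [hj]

/-- The coefficient map of an unconditional basis. -/
noncomputable def IsUnconditionalBasis.coeff (h : IsUnconditionalBasis 𝕜 e) :
    X →ₗ[𝕜] ι → 𝕜 where
  toFun x := (h x).choose
  map_add' x y := by
    refine (h (x + y)).unique (h (x + y)).choose_spec.1 ?_
    simpa [add_smul] using (h x).choose_spec.1.add (h y).choose_spec.1
  map_smul' c x := by
    refine (h (c • x)).unique (h (c • x)).choose_spec.1 ?_
    simpa [mul_smul] using (h x).choose_spec.1.const_smul c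

theorem IsUnconditionalBasis.hasSum_coeff (h : IsUnconditionalBasis 𝕜 e) (x : X) :
    HasSum (fun i => h.coeff x i • e i) x :=
  (h x).choose_spec.1

theorem IsUnconditionalBasis.coeff_eq (h : IsUnconditionalBasis 𝕜 e) {x : X} {a : ι → 𝕜}
    (ha : HasSum (fun i => a i • e i) x) : h.coeff x = a :=
  (h x).unique (h.hasSum_coeff x) ha

theorem IsUnconditionalBasis.coeff_self [DecidableEq ι] (h : IsUnconditionalBasis 𝕜 e) (i : ι) :
    h.coeff (e i) = Pi.single i 1 :=
  h.coeff_eq (hasSum_single_smul e i)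

/-- The map sending a vector to the family of all finite partial sums of its expansion. -/
noncomputable def IsUnconditionalBasis.partialSums (h : IsUnconditionalBasis 𝕜 e) :
    X →ₗ[𝕜] lp (fun _ : Finset ι => X) ∞ where
  toFun x := ⟨fun A => ∑ i ∈ A, h.coeff x i • e i,
    memℓp_infty (bddAbove_norm_sum_of_summable (h.hasSum_coeff x).summable)⟩
  map_add' x y := by
    ext A
    simp only [map_add, Pi.add_apply, add_smul, Finset.sum_add_distrib]
    rfl
  map_smul' c x := by
    ext A
    simp [mul_smul, Finset.smul_sum]

theorem IsUnconditionalBasis.partialSums_apply (h : IsUnconditionalBasis 𝕜 e) (x : X)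
    (A : Finset ι) : h.partialSums x A = ∑ i ∈ A, h.coeff x i • e i := rfl

-- Closed graph theorem. Each line spanned by `e i` is closed, so a limit `F` of partial-sum
-- families again consists of partial sums, with scalars `b`. Convergence is uniform in `A`, so
-- these sums converge to `x`, and uniqueness identifies `b` with the coefficients of `x`.
open Filter Topology in
theorem IsUnconditionalBasis.continuous_partialSums [CompleteSpace X]
    (h : IsUnconditionalBasis 𝕜 e) : Continuous h.partialSums := by
  refine h.partialSums.continuous_of_seq_closed_graph fun u x F hu hF => ?_
  have hF' : ∀ A, Tendsto (fun n => h.partialSums (u n) A) atTop (𝓝 (F A)) := fun A =>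
    tendsto_iff_norm_sub_tendsto_zero.2 <| squeeze_zero (fun _ => norm_nonneg _)
      (fun n => lp.norm_apply_le_norm ENNReal.top_ne_zero (h.partialSums (u n) - F) A)
      (tendsto_iff_norm_sub_tendsto_zero.1 hF)
  have hb : ∀ i, ∃ b : 𝕜, F {i} = b • e i := fun i => by
    have hc : IsClosed (Submodule.span 𝕜 {e i} : Set X) := Submodule.closed_of_finiteDimensional _
    have hm : F {i} ∈ (Submodule.span 𝕜 {e i} : Set X) := by
      refine hc.mem_of_tendsto (hF' {i}) (Eventually.of_forall fun n => ?_)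
      rw [h.partialSums_apply, Finset.sum_singleton]
      exact Submodule.smul_mem _ _ (Submodule.mem_span_singleton_self _)
    obtain ⟨b, hb⟩ := Submodule.mem_span_singleton.1 hm
    exact ⟨b, hb.symm⟩
  choose b hb using hb
  have hFA : ∀ A, F A = ∑ i ∈ A, b i • e i := fun A => by
    refine tendsto_nhds_unique (hF' A) ?_
    simp only [h.partialSums_apply]
    refine tendsto_finsetSum _ fun i _ => ?_
    have := hF' {i}
    simpa only [h.partialSums_apply, Finset.sum_singleton, hb] using this
  have hs : HasSum (fun i => b i • e i) x := by
    rw [HasSum, SummationFilter.unconditional_filter, Metric.tendsto_nhds]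
    intro ε hε
    obtain ⟨n, h1, h2⟩ := ((Metric.tendsto_nhds.1 hF (ε / 3) (by positivity)).and
      (Metric.tendsto_nhds.1 hu (ε / 3) (by positivity))).exists
    have h3 := h.hasSum_coeff (u n)
    rw [HasSum, SummationFilter.unconditional_filter, Metric.tendsto_nhds] at h3
    filter_upwards [h3 (ε / 3) (by positivity)] with A hA
    rw [← hFA]
    have h4 : dist (F A) (h.partialSums (u n) A) ≤ dist (h.partialSums (u n)) F := by
      rw [dist_comm (F A), dist_eq_norm, dist_eq_norm]
      exact lp.norm_apply_le_norm ENNReal.top_ne_zero (h.partialSums (u n) - F) A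
    rw [← h.partialSums_apply] at hA
    rw [Function.comp_apply] at h1
    linarith [dist_triangle4 (F A) (h.partialSums (u n) A) (u n) x]
  ext A
  rw [hFA, h.partialSums_apply, h.coeff_eq hs]

/-- The partial sum operators of an unconditional basis are uniformly bounded. -/
theorem IsUnconditionalBasis.exists_norm_sum_le [CompleteSpace X]
    (h : IsUnconditionalBasis 𝕜 e) :
    ∃ K : ℝ, 0 < K ∧ ∀ x (A : Finset ι), ‖∑ i ∈ A, h.coeff x i • e i‖ ≤ K * ‖x‖ := by
  obtain ⟨K, hK, hb⟩ := ContinuousLinearMap.bound ⟨h.partialSums, h.continuous_partialSums⟩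
  exact ⟨K, hK, fun x A =>
    (lp.norm_apply_le_norm ENNReal.top_ne_zero (h.partialSums x) A).trans (hb x)⟩

theorem IsUnconditionalBasisOf.isUnconditionalBasis
    (h : IsUnconditionalBasisOf (⊤ : Submodule 𝕜 X) e) : IsUnconditionalBasis 𝕜 e := by
  obtain ⟨hm, hb⟩ := h
  intro x
  have key : ∀ a : ι → 𝕜, HasSum (fun i => a i • (⟨e i, hm i⟩ : (⊤ : Submodule 𝕜 X)))
      ⟨x, trivial⟩ ↔ HasSum (fun i => a i • e i) x := fun a =>
    (Topology.IsInducing.subtypeVal.hasSum_iff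
      (g := (⊤ : Submodule 𝕜 X).subtype) _ _).symm
  obtain ⟨a, ha, hu⟩ := hb ⟨x, trivial⟩
  exact ⟨a, (key a).1 ha, fun b hb => hu b ((key b).2 hb)⟩

end UnconditionalBasis

/-! ### Averaging over subsets and integrating over disjoint sets. -/

/-- Pair each `A` avoiding `i` with `insert i A`: the two sums differ by `b i`, so they cannot both
be small. This replaces an average over random signs. -/
theorem two_pow_card_mul_enorm_rpow_le {E ι : Type*} [NormedAddCommGroup E] (b : ι → E)
    {F : Finset ι} {i : ι} (hi : i ∈ F) {q : ℝ} (hq : 1 ≤ q) :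
    2 ^ F.card * ‖b i‖ₑ ^ q ≤ 2 ^ q * ∑ A ∈ F.powerset, ‖∑ j ∈ A, b j‖ₑ ^ q := by
  classical
  have hF : insert i (F.erase i) = F := Finset.insert_erase hi
  have hni : i ∉ F.erase i := Finset.notMem_erase i F
  have hcard : F.card = (F.erase i).card + 1 := by rw [← Finset.card_insert_of_notMem hni, hF]
  have hpt : ∀ A ∈ (F.erase i).powerset, ‖b i‖ₑ ^ q ≤
      2 ^ (q - 1) * (‖∑ j ∈ A, b j‖ₑ ^ q + ‖∑ j ∈ insert i A, b j‖ₑ ^ q) := by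
    intro A hA
    have hiA : i ∉ A := fun h => hni (Finset.mem_powerset.1 hA h)
    have h1 : b i = ∑ j ∈ insert i A, b j - ∑ j ∈ A, b j := by
      rw [Finset.sum_insert hiA]; abel
    have h2 : ‖b i‖ₑ ≤ ‖∑ j ∈ A, b j‖ₑ + ‖∑ j ∈ insert i A, b j‖ₑ := by
      rw [add_comm]
      conv_lhs => rw [h1]
      exact enorm_sub_le
    exact (ENNReal.rpow_le_rpow h2 (by linarith)).trans
      (ENNReal.rpow_add_le_mul_rpow_add_rpow _ _ hq)
  have hsum := Finset.sum_le_sum hpt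
  rw [Finset.sum_const, Finset.card_powerset, ← Finset.mul_sum, Finset.sum_add_distrib,
    ← Finset.sum_powerset_insert hni, hF, nsmul_eq_mul] at hsum
  push_cast at hsum
  calc 2 ^ F.card * ‖b i‖ₑ ^ q = 2 * (2 ^ (F.erase i).card * ‖b i‖ₑ ^ q) := by
        rw [hcard, pow_succ]; ring
    _ ≤ 2 * (2 ^ (q - 1) * ∑ A ∈ F.powerset, ‖∑ j ∈ A, b j‖ₑ ^ q) := by gcongr
    _ = 2 ^ q * ∑ A ∈ F.powerset, ‖∑ j ∈ A, b j‖ₑ ^ q := by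
        rw [← mul_assoc]
        congr 1
        conv_lhs => rw [← ENNReal.rpow_one 2]
        rw [← ENNReal.rpow_mul, ← ENNReal.rpow_add _ _ two_ne_zero ENNReal.ofNat_ne_top]
        congr 1; ring

/-- Disjointness holds only within a class of `k`, so each class costs one full integral. -/
theorem sum_setLIntegral_le_sum_lintegral {α ι κ : Type*} [MeasurableSpace α] {μ : Measure α}
    [Fintype κ] (F : Finset ι) (k : ι → κ) {B : ι → Set α} (hB : ∀ i, MeasurableSet (B i))
    (hd : ∀ i j, i ≠ j → k i = k j → Disjoint (B i) (B j)) (g : κ → α → ℝ≥0∞) :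
    ∑ i ∈ F, ∫⁻ x in B i, g (k i) x ∂μ ≤ ∑ l, ∫⁻ x, g l x ∂μ := by
  classical
  rw [← Finset.sum_fiberwise F k]
  refine Finset.sum_le_sum fun l _ => ?_
  calc ∑ i ∈ F with k i = l, ∫⁻ x in B i, g (k i) x ∂μ
      = ∑ i ∈ F with k i = l, ∫⁻ x in B i, g l x ∂μ :=
        Finset.sum_congr rfl fun i hi => by rw [(Finset.mem_filter.1 hi).2]
    _ = ∫⁻ x in ⋃ i ∈ F.filter (k · = l), B i, g l x ∂μ := by
        refine (lintegral_biUnion_finset (fun i hi j hj hij => hd i j hij ?_)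
          (fun i _ => hB i) _).symm
        rw [(Finset.mem_filter.1 hi).2, (Finset.mem_filter.1 hj).2]
    _ ≤ _ := setLIntegral_le_lintegral _ _

/-! ### From q-summability with q ≤ 2 to square summability. -/

section SquareSummability

/-- Each term is at most `M`, hence t² ≤ t^q M^(2-q). -/
theorem sum_sq_le_of_sum_rpow_le {ι : Type*} {F : Finset ι} {t : ι → ℝ} (ht : ∀ i, 0 ≤ t i)
    {q M : ℝ} (hq0 : 0 < q) (hq2 : q ≤ 2) (hM : 0 ≤ M) (h : ∑ i ∈ F, t i ^ q ≤ M ^ q) :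
    ∑ i ∈ F, t i ^ 2 ≤ M ^ 2 := by
  have hle : ∀ i ∈ F, t i ≤ M := fun i hi => (Real.rpow_le_rpow_iff (ht i) hM hq0).1 <|
    (Finset.single_le_sum (f := fun i => t i ^ q) (fun j _ => Real.rpow_nonneg (ht j) q) hi).trans h
  have hsplit : ∀ s : ℝ, 0 ≤ s → s ^ 2 = s ^ q * s ^ (2 - q) := fun s hs => by
    rw [← Real.rpow_add_of_nonneg hs hq0.le (by linarith), ← Real.rpow_natCast]
    congr 1; push_cast; ring
  calc ∑ i ∈ F, t i ^ 2 ≤ ∑ i ∈ F, t i ^ q * M ^ (2 - q) := by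
        refine Finset.sum_le_sum fun i hi => ?_
        rw [hsplit _ (ht i)]
        exact mul_le_mul_of_nonneg_left
          (Real.rpow_le_rpow (ht i) (hle i hi) (by linarith)) (Real.rpow_nonneg (ht i) q)
    _ = (∑ i ∈ F, t i ^ q) * M ^ (2 - q) := by rw [Finset.sum_mul]
    _ ≤ M ^ q * M ^ (2 - q) := mul_le_mul_of_nonneg_right h (Real.rpow_nonneg hM _)
    _ = M ^ 2 := (hsplit M hM).symm

/-- If the coefficients are bounded in `ℓ^q` by the norm of the vector and the images `R (e i)`
are `q`-summable with `q ≤ 2`, then `R` is small on the common kernel of finitely many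
coefficient functionals. -/
theorem exists_finset_norm_le_half {𝕜 X Y ι : Type*} [RCLike 𝕜] [NormedAddCommGroup X]
    [NormedSpace 𝕜 X] [NormedAddCommGroup Y] [NormedSpace 𝕜 Y] {e : ι → X} {a : X → ι → 𝕜}
    (ha : ∀ x, HasSum (fun i => a x i • e i) x) (R : X →L[𝕜] Y) {q D D' : ℝ} (hq0 : 0 < q)
    (hq2 : q ≤ 2) (hD : 0 < D) (haD : ∀ x (F : Finset ι), ∑ i ∈ F, ‖a x i‖ ^ q ≤ (D * ‖x‖) ^ q)
    (hD' : 0 ≤ D') (hRD : ∀ F : Finset ι, ∑ i ∈ F, ‖R (e i)‖ ^ q ≤ D' ^ q) :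
    ∃ A : Finset ι, ∀ x, (∀ i ∈ A, a x i = 0) → ‖R x‖ ≤ ‖x‖ / 2 := by
  classical
  have hs : Summable fun i => ‖R (e i)‖ ^ 2 :=
    summable_of_sum_le (fun _ => by positivity) fun F =>
      sum_sq_le_of_sum_rpow_le (fun _ => norm_nonneg _) hq0 hq2 hD' (hRD F)
  -- The tail size 1/(2D) against the coefficient bound D‖x‖ yields ‖x‖/2.
  obtain ⟨A, hA⟩ := summable_iff_vanishing_norm.1 hs ((1 / (2 * D)) ^ 2) (by positivity)
  refine ⟨A, fun x hx => ?_⟩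
  have hR : HasSum (fun i => a x i • R (e i)) (R x) := by
    simpa using (ha x).mapL R
  refine le_of_tendsto hR.norm (Filter.Eventually.of_forall fun F => ?_)
  have h1 : ∑ i ∈ F, a x i • R (e i) = ∑ i ∈ F \ A, a x i • R (e i) := by
    refine (Finset.sum_subset Finset.sdiff_subset fun i hi hiA => ?_).symm
    rw [hx i (by simpa [hi] using hiA), zero_smul]
  have h2 : ‖∑ i ∈ F \ A, a x i • R (e i)‖ ≤ ∑ i ∈ F \ A, ‖a x i‖ * ‖R (e i)‖ :=
    (norm_sum_le _ _).trans (Finset.sum_le_sum fun i _ => (norm_smul _ _).le)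
  have h3 : ∑ i ∈ F \ A, ‖R (e i)‖ ^ 2 ≤ (1 / (2 * D)) ^ 2 :=
    (Real.le_norm_self _).trans (hA _ Finset.sdiff_disjoint).le
  have h4 : ∑ i ∈ F \ A, ‖a x i‖ ^ 2 ≤ (D * ‖x‖) ^ 2 :=
    sum_sq_le_of_sum_rpow_le (fun _ => norm_nonneg _) hq0 hq2 (by positivity) (haD x _)
  change ‖∑ i ∈ F, a x i • R (e i)‖ ≤ _
  rw [h1]
  refine h2.trans (abs_le_of_sq_le_sq' ?_ (by positivity)).2
  calc (∑ i ∈ F \ A, ‖a x i‖ * ‖R (e i)‖) ^ 2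
      ≤ (∑ i ∈ F \ A, ‖a x i‖ ^ 2) * ∑ i ∈ F \ A, ‖R (e i)‖ ^ 2 :=
        Finset.sum_mul_sq_le_sq_mul_sq _ _ _
    _ ≤ (D * ‖x‖) ^ 2 * (1 / (2 * D)) ^ 2 :=
        mul_le_mul h4 h3 (Finset.sum_nonneg fun _ _ => by positivity) (by positivity)
    _ = (‖x‖ / 2) ^ 2 := by field_simp

end SquareSummability

/-! ### Norms, finite sums and restrictions in L^p. -/

section LpLemmas

variable {𝕜 : Type*} [RCLike 𝕜] {α : Type*} [MeasurableSpace α] {μ : Measure α} {p : ℝ≥0∞}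

theorem enorm_rpow_eq_lintegral (hp0 : p ≠ 0) (hp : p ≠ ∞) (f : Lp 𝕜 p μ) :
    ‖f‖ₑ ^ p.toReal = ∫⁻ x, ‖f x‖ₑ ^ p.toReal ∂μ := by
  rw [Lp.enorm_def, eLpNorm_eq_lintegral_rpow_enorm_toReal hp0 hp, ← ENNReal.rpow_mul,
    one_div_mul_cancel (ENNReal.toReal_pos hp0 hp).ne', ENNReal.rpow_one]

theorem coeFn_sum_smul {ι : Type*} (A : Finset ι) (a : ι → 𝕜) (e : ι → Lp 𝕜 p μ) :
    ⇑(∑ i ∈ A, a i • e i) =ᵐ[μ] fun x => ∑ i ∈ A, a i • e i x := by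
  classical
  induction A using Finset.induction_on with
  | empty => simp only [Finset.sum_empty]; exact Lp.coeFn_zero 𝕜 p μ
  | insert i A hi ih =>
    rw [Finset.sum_insert hi]
    filter_upwards [Lp.coeFn_add (a i • e i) (∑ i ∈ A, a i • e i), Lp.coeFn_smul (a i) (e i), ih]
      with x h1 h2 h3
    rw [h1, Pi.add_apply, h2, h3, Finset.sum_insert hi, Pi.smul_apply]

theorem enorm_LpToLpRestrictCLM_rpow [Fact (1 ≤ p)] (hp : p ≠ ∞) (s : Set α) (f : Lp 𝕜 p μ) :
    ‖LpToLpRestrictCLM α 𝕜 𝕜 μ p s f‖ₑ ^ p.toReal = ∫⁻ x in s, ‖f x‖ₑ ^ p.toReal ∂μ := by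
  rw [enorm_rpow_eq_lintegral (one_pos.trans_le Fact.out).ne' hp]
  refine lintegral_congr_ae ?_
  filter_upwards [LpToLpRestrictCLM_coeFn 𝕜 s f] with x hx
  rw [hx]

theorem norm_LpToLpRestrictCLM_eq [Fact (1 ≤ p)] {s : Set α} {f : Lp 𝕜 p μ} {g : α → 𝕜}
    (hfg : f =ᵐ[μ] g) (hg : Function.support g ⊆ s) :
    ‖LpToLpRestrictCLM α 𝕜 𝕜 μ p s f‖ = ‖f‖ := by
  rw [Lp.norm_def, Lp.norm_def, eLpNorm_congr_ae (LpToLpRestrictCLM_coeFn 𝕜 s f),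
    eLpNorm_congr_ae (ae_restrict_of_ae hfg), eLpNorm_congr_ae hfg,
    eLpNorm_restrict_eq_of_support_subset hg]

end LpLemmas

/-! ### Translations and functions supported in a ball. -/

section Translation

variable {𝕜 : Type*} [RCLike 𝕜] {d : ℕ} {p : ℝ≥0∞}

theorem norm_lpTranslate (γ : EuclideanSpace ℝ (Fin d))
    (f : Lp 𝕜 p (volume : Measure (EuclideanSpace ℝ (Fin d)))) : ‖lpTranslate γ f‖ = ‖f‖ :=
  Lp.norm_compMeasurePreserving f _

theorem lpTranslate_sub (γ : EuclideanSpace ℝ (Fin d))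
    (f g : Lp 𝕜 p (volume : Measure (EuclideanSpace ℝ (Fin d)))) :
    lpTranslate γ (f - g) = lpTranslate γ f - lpTranslate γ g :=
  map_sub (Lp.compMeasurePreserving _ _) f g

theorem lpTranslate_lpTranslate (γ γ' : EuclideanSpace ℝ (Fin d))
    (f : Lp 𝕜 p (volume : Measure (EuclideanSpace ℝ (Fin d)))) :
    lpTranslate γ (lpTranslate γ' f) = lpTranslate (γ + γ') f := by
  refine Lp.ext ?_
  have h := (measurePreserving_sub_right (volume : Measure (EuclideanSpace ℝ (Fin d)))
    γ).quasiMeasurePreserving.ae_eq_comp (coeFn_lpTranslate γ' f)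
  filter_upwards [coeFn_lpTranslate γ (lpTranslate γ' f), coeFn_lpTranslate (γ + γ') f, h]
    with x h1 h2 h3
  rw [h1, h2]
  simpa [sub_sub] using h3

theorem setLIntegral_lpTranslate (γ : EuclideanSpace ℝ (Fin d)) (q : ℝ)
    (f : Lp 𝕜 p (volume : Measure (EuclideanSpace ℝ (Fin d))))
    (s : Set (EuclideanSpace ℝ (Fin d))) :
    ∫⁻ x in (fun x => x - γ) ⁻¹' s, ‖lpTranslate γ f x‖ₑ ^ q = ∫⁻ x in s, ‖f x‖ₑ ^ q := by
  rw [← (measurePreserving_sub_right volume γ).setLIntegral_comp_preimage_emb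
    (measurableEmbedding_subRight γ) (fun x => ‖f x‖ₑ ^ q) s]
  refine lintegral_congr_ae (ae_restrict_of_ae ?_)
  filter_upwards [coeFn_lpTranslate γ f] with x hx
  rw [hx]

open Filter Topology in
theorem tendsto_lpTranslate [Fact (1 ≤ p)] (hp : p ≠ ∞)
    (f : Lp 𝕜 p (volume : Measure (EuclideanSpace ℝ (Fin d)))) :
    Tendsto (fun γ => lpTranslate γ f) (𝓝 0) (𝓝 f) := by
  have h0 : lpTranslate 0 f = f := by
    refine Lp.ext ?_
    filter_upwards [coeFn_lpTranslate 0 f] with x hx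
    rw [hx, sub_zero]
  let g : C(EuclideanSpace ℝ (Fin d) × EuclideanSpace ℝ (Fin d), EuclideanSpace ℝ (Fin d)) :=
    ⟨fun z => z.2 - z.1, by fun_prop⟩
  have h := Filter.Tendsto.compMeasurePreservingLp (μ := volume) (ν := volume) (l := 𝓝 0)
    (f := fun _ : EuclideanSpace ℝ (Fin d) => f) tendsto_const_nhds
    (g.curry.continuous.tendsto 0) (fun γ => measurePreserving_sub_right volume γ)
    (measurePreserving_sub_right volume 0) hp
  conv_rhs => rw [← h0]
  exact h

/-- Translations are isometries, so continuity at 0 is uniform. -/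
theorem exists_dist_le_of_le_norm_sub_lpTranslate [Fact (1 ≤ p)] (hp : p ≠ ∞)
    (f : Lp 𝕜 p (volume : Measure (EuclideanSpace ℝ (Fin d)))) {c : ℝ} (hc : 0 < c) :
    ∃ δ > 0, ∀ γ γ', c ≤ ‖lpTranslate γ f - lpTranslate γ' f‖ → δ ≤ dist γ γ' := by
  obtain ⟨δ, hδ, h⟩ := Metric.eventually_nhds_iff.1
    (Metric.tendsto_nhds.1 (tendsto_lpTranslate hp f) c hc)
  refine ⟨δ, hδ, fun γ γ' hγ => not_lt.1 fun hlt => hγ.not_gt ?_⟩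
  have h1 := h (y := γ - γ') (by rwa [dist_zero_right, ← dist_eq_norm])
  rw [dist_eq_norm] at h1
  have h2 : lpTranslate γ f - lpTranslate γ' f
      = lpTranslate γ' (lpTranslate (γ - γ') f - f) := by
    rw [lpTranslate_sub, lpTranslate_lpTranslate, add_sub_cancel]
  rwa [h2, norm_lpTranslate]

theorem exists_ball_lintegral_pos {f : Lp 𝕜 p (volume : Measure (EuclideanSpace ℝ (Fin d)))}
    (hf : f ≠ 0) {q r : ℝ} (hq : 0 < q) (hr : 0 < r) :
    ∃ y, 0 < ∫⁻ x in Metric.ball y r, ‖f x‖ₑ ^ q := by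
  by_contra! h
  have hm : AEMeasurable (fun x => ‖f x‖ₑ ^ q) volume :=
    (Lp.aestronglyMeasurable f).enorm.pow_const q
  have h0 : volume {x | f x ≠ 0} = 0 := by
    refine measure_null_of_locally_null _ fun y _ => ?_
    refine ⟨_, inter_mem_nhdsWithin _ (Metric.ball_mem_nhds y hr), ?_⟩
    have h1 := (lintegral_eq_zero_iff' hm.restrict).1 (nonpos_iff_eq_zero.1 (h y))
    rw [Filter.EventuallyEq, ae_restrict_iff' measurableSet_ball] at h1
    refine measure_mono_null (fun x hx => ?_) (ae_iff.1 h1)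
    simpa [hq, hq.not_gt, and_comm] using hx
  refine hf (Lp.ext ?_)
  filter_upwards [ae_iff.2 h0, Lp.coeFn_zero 𝕜 p volume] with x hx hx0
  rw [hx, hx0, Pi.zero_apply]

/-- Dimension count: the ball contains one more disjoint shell than there are functionals, so some
nonzero combination of shell indicators is annihilated. -/
theorem exists_ne_zero_norm_restrict_ball_eq [Fact (1 ≤ p)] (hd : 1 ≤ d) {r : ℝ}
    (hr : 0 < r) {κ : Type*} [Fintype κ]
    (φ : Lp 𝕜 p (volume : Measure (EuclideanSpace ℝ (Fin d))) →ₗ[𝕜] κ → 𝕜) :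
    ∃ x, x ≠ 0 ∧ φ x = 0 ∧
      ‖LpToLpRestrictCLM (EuclideanSpace ℝ (Fin d)) 𝕜 𝕜 volume p (Metric.ball 0 r) x‖ = ‖x‖ := by
  classical
  have : Nonempty (Fin d) := ⟨⟨0, hd⟩⟩
  set m := Fintype.card κ + 1
  have hm : (0 : ℝ) < m := by simp only [m]; positivity
  let U : Fin m → Set (EuclideanSpace ℝ (Fin d)) := fun j =>
    {x | (j : ℝ) < ‖x‖ * (m / r) ∧ ‖x‖ * (m / r) < j + 1}
  have hUo : ∀ j, IsOpen (U j) := fun j => by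
    have h : Continuous fun x : EuclideanSpace ℝ (Fin d) => ‖x‖ * (m / r) := by fun_prop
    exact (isOpen_lt continuous_const h).inter (isOpen_lt h continuous_const)
  have hUb : ∀ j, U j ⊆ Metric.ball 0 r := fun j x hx => by
    rw [mem_ball_zero_iff]
    have h1 : ‖x‖ * (m / r) < m := hx.2.trans_le (by exact_mod_cast j.2)
    rwa [← mul_div_assoc, div_lt_iff₀ hr, mul_comm, mul_lt_mul_iff_right₀ hm] at h1
  have hUd : ∀ i j x, x ∈ U i → x ∈ U j → i = j := fun i j x hi hj => by
    have h1 : (i : ℝ) < j + 1 := hi.1.trans hj.2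
    have h2 : (j : ℝ) < i + 1 := hj.1.trans hi.2
    norm_cast at h1 h2
    omega
  have hUf : ∀ j, volume (U j) ≠ ∞ := fun j =>
    ((measure_mono (hUb j)).trans_lt measure_ball_lt_top).ne
  have hUp : ∀ j, 0 < volume (U j) := fun j => by
    refine (hUo j).measure_pos _ ?_
    obtain ⟨x, hx⟩ := exists_norm_eq (EuclideanSpace ℝ (Fin d))
      (c := ((j : ℝ) + 1 / 2) * (r / m)) (by positivity)
    refine ⟨x, ?_⟩
    have : ‖x‖ * (m / r) = j + 1 / 2 := by rw [hx]; field_simp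
    simp only [U, Set.mem_ofPred_eq, this]
    constructor <;> linarith
  let u : Fin m → Lp 𝕜 p (volume : Measure (EuclideanSpace ℝ (Fin d))) := fun j =>
    indicatorConstLp p (hUo j).measurableSet (hUf j) 1
  obtain ⟨c, hc, hc0⟩ := (LinearMap.ker (φ ∘ₗ Fintype.linearCombination 𝕜 u)).ne_bot_iff.1
    (LinearMap.ker_ne_bot_of_finrank_lt (by simp [m]))
  let g : EuclideanSpace ℝ (Fin d) → 𝕜 := fun x => ∑ j, c j • (U j).indicator (fun _ => 1) x
  have hg : ⇑(∑ j, c j • u j) =ᵐ[volume] g := by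
    have hu : ∀ᵐ x ∂volume, ∀ j, u j x = (U j).indicator (fun _ => (1 : 𝕜)) x :=
      ae_all_iff.2 fun j => indicatorConstLp_coeFn
    filter_upwards [coeFn_sum_smul Finset.univ c u, hu] with x h1 h2
    simp only [h1, h2, g]
  have hgU : ∀ j, ∀ x ∈ U j, g x = c j := fun j x hx => by
    simp only [g]
    rw [Finset.sum_eq_single j (fun i _ hij => ?_) (by simp)]
    · simp [hx]
    · rw [Set.indicator_of_notMem (fun hi => hij (hUd i j x hi hx)), smul_zero]
  refine ⟨∑ j, c j • u j, fun h0 => hc0 ?_, ?_, norm_LpToLpRestrictCLM_eq hg ?_⟩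
  · ext j
    by_contra hj
    refine (hUp j).ne' ?_
    have h1 : ∀ᵐ x ∂volume, g x = 0 := by
      rw [h0] at hg
      filter_upwards [hg, Lp.coeFn_zero 𝕜 p volume] with x h1 h2
      rw [← h1, h2, Pi.zero_apply]
    refine measure_mono_null (fun x hx => ?_) (ae_iff.1 h1)
    simpa [hgU j x hx] using hj
  · simpa [Fintype.linearCombination_apply] using hc
  · intro x hx
    by_contra hxb
    refine hx (Finset.sum_eq_zero fun j _ => ?_)
    rw [Set.indicator_of_notMem (fun hj => hxb (hUb j hj)), smul_zero]

end Translation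

/-! ### Bases of translates and the contradiction. -/

section TranslateSystem

variable {𝕜 : Type*} [RCLike 𝕜] {d n : ℕ} {p : ℝ≥0∞} [Fact (1 ≤ p)]
  {f : Fin n → Lp 𝕜 p (volume : Measure (EuclideanSpace ℝ (Fin d)))}
  {ι : Fin n → Type*} {Γ : ∀ k, ι k → EuclideanSpace ℝ (Fin d)}

/-- The difference of two distinct basis elements has a coefficient 1, so its norm is at least `K⁻¹
* ‖f k‖`; continuity of translation then separates the points. -/
theorem IsUnconditionalBasis.exists_separation (hp : p ≠ ∞) (hf : ∀ k, f k ≠ 0)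
    (h : IsUnconditionalBasis 𝕜 (translateSystem f Γ)) :
    ∃ δ > 0, ∀ i j : Σ k, ι k, i ≠ j → i.1 = j.1 → δ ≤ dist (Γ i.1 i.2) (Γ j.1 j.2) := by
  classical
  obtain ⟨K, hK, hb⟩ := h.exists_norm_sum_le
  have hk : ∀ k, ∃ δ > 0, ∀ γ γ',
      K⁻¹ * ‖f k‖ ≤ ‖lpTranslate γ (f k) - lpTranslate γ' (f k)‖ → δ ≤ dist γ γ' := fun k =>
    exists_dist_le_of_le_norm_sub_lpTranslate hp (f k)
      (mul_pos (inv_pos.2 hK) (norm_pos_iff.2 (hf k)))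
  choose δ hδ hδd using hk
  -- A common lower bound for the `δ k` that also covers `n = 0`.
  have hev : ∀ᶠ ε in nhdsWithin (0 : ℝ) (Set.Ioi 0), 0 < ε ∧ ∀ k, ε < δ k :=
    (eventually_mem_nhdsWithin (a := (0 : ℝ)) (s := Set.Ioi 0)).and
      (Filter.eventually_all.2 fun k => nhdsWithin_le_nhds (eventually_lt_nhds (hδ k)))
  obtain ⟨ε, hε, hεδ⟩ := hev.exists
  refine ⟨ε, hε, ?_⟩
  rintro ⟨k, i⟩ ⟨l, j⟩ hij (rfl : k = l)
  refine (hεδ k).le.trans (hδd k _ _ ?_)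
  have h1 := hb (translateSystem f Γ ⟨k, i⟩ - translateSystem f Γ ⟨k, j⟩) {⟨k, i⟩}
  rw [Finset.sum_singleton, map_sub, h.coeff_self, h.coeff_self, Pi.sub_apply, Pi.single_eq_same,
    Pi.single_eq_of_ne hij, sub_zero, one_smul] at h1
  simp only [translateSystem, norm_lpTranslate] at h1
  rwa [inv_mul_le_iff₀ hK]

/-- Expansions in an unconditional basis of translates have `ℓ^p` coefficients. -/
theorem IsUnconditionalBasis.exists_sum_enorm_coeff_rpow_le (hp : p ≠ ∞) (hf : ∀ k, f k ≠ 0)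
    (h : IsUnconditionalBasis 𝕜 (translateSystem f Γ)) :
    ∃ C : ℝ≥0∞, C ≠ ∞ ∧ ∀ x (F : Finset (Σ k, ι k)),
      ∑ i ∈ F, ‖h.coeff x i‖ₑ ^ p.toReal ≤ C * ‖x‖ₑ ^ p.toReal := by
  have hp1 : (1 : ℝ≥0∞) ≤ p := Fact.out
  have hp0 : p ≠ 0 := (one_pos.trans_le hp1).ne'
  set q := p.toReal with hq
  have hq1 : 1 ≤ q := (ENNReal.ofReal_le_iff_le_toReal hp).1 (by simpa using hp1)
  have hq0 : 0 < q := by linarith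
  obtain ⟨K, hK, hb⟩ := h.exists_norm_sum_le
  obtain ⟨δ, hδ, hsep⟩ := h.exists_separation hp hf
  -- Radius δ/2 makes the translates of this ball by `Γ k` disjoint, each carrying the same mass `c
  -- k`.
  choose y hy using fun k => exists_ball_lintegral_pos (hf k) hq0 (half_pos hδ)
  let c : Fin n → ℝ≥0∞ := fun k => ∫⁻ x in Metric.ball (y k) (δ / 2), ‖f k x‖ₑ ^ q
  have hc : ∀ k, (c k)⁻¹ ≠ ∞ := fun k => ENNReal.inv_ne_top.2 (hy k).ne'
  have hct : ∀ k, c k ≠ ∞ := fun k => by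
    refine ((setLIntegral_le_lintegral _ _).trans_lt ?_).ne
    rw [← enorm_rpow_eq_lintegral hp0 hp]
    exact ENNReal.rpow_lt_top_of_nonneg hq0.le enorm_ne_top
  let B : (Σ k, ι k) → Set (EuclideanSpace ℝ (Fin d)) := fun i =>
    (fun x => x - Γ i.1 i.2) ⁻¹' Metric.ball (y i.1) (δ / 2)
  have hB : ∀ i, MeasurableSet (B i) := fun i =>
    measurableSet_ball.preimage (measurable_id.sub_const _)
  have hBd : ∀ i j, i ≠ j → i.1 = j.1 → Disjoint (B i) (B j) := by
    intro i j hij hk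
    refine Set.disjoint_left.2 fun x hx hx' => (hsep i j hij hk).not_gt ?_
    simp only [B, Set.mem_preimage, Metric.mem_ball] at hx hx'
    rw [show y j.1 = y i.1 by rw [hk]] at hx'
    have h1 := dist_triangle_right (x - Γ i.1 i.2) (x - Γ j.1 j.2) (y i.1)
    rw [dist_sub_left] at h1
    linarith
  refine ⟨(∑ k, (c k)⁻¹) * (n * (2 ^ q * ENNReal.ofReal K ^ q)),
    ENNReal.mul_ne_top (ENNReal.sum_ne_top.2 fun k _ => hc k) ?_, fun x F => ?_⟩
  · exact ENNReal.mul_ne_top (ENNReal.natCast_ne_top n) (ENNReal.mul_ne_top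
      (ENNReal.rpow_ne_top_of_nonneg hq0.le ENNReal.ofNat_ne_top)
      (ENNReal.rpow_ne_top_of_nonneg hq0.le ENNReal.ofReal_ne_top))
  let e := translateSystem f Γ
  let a := h.coeff x
  let G : EuclideanSpace ℝ (Fin d) → ℝ≥0∞ := fun z =>
    2 ^ q * ∑ A ∈ F.powerset, ‖∑ i ∈ A, a i • e i z‖ₑ ^ q
  have hG : ∫⁻ z, G z ≤ 2 ^ F.card * (2 ^ q * ENNReal.ofReal K ^ q * ‖x‖ₑ ^ q) := by
    have hmeas : ∀ A ∈ F.powerset,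
        AEMeasurable (fun z => ‖∑ i ∈ A, a i • e i z‖ₑ ^ q) volume := fun A _ =>
      ((Lp.aestronglyMeasurable (∑ i ∈ A, a i • e i)).congr
        (coeFn_sum_smul A a e)).enorm.pow_const q
    have hA : ∀ A ∈ F.powerset, ∫⁻ z, ‖∑ i ∈ A, a i • e i z‖ₑ ^ q
        ≤ ENNReal.ofReal K ^ q * ‖x‖ₑ ^ q := fun A _ => by
      rw [← ENNReal.mul_rpow_of_nonneg _ _ hq0.le]
      calc ∫⁻ z, ‖∑ i ∈ A, a i • e i z‖ₑ ^ q = ‖∑ i ∈ A, a i • e i‖ₑ ^ q := by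
            rw [hq, enorm_rpow_eq_lintegral hp0 hp]
            refine lintegral_congr_ae ?_
            filter_upwards [coeFn_sum_smul A a e] with z hz
            rw [hz]
        _ ≤ (ENNReal.ofReal K * ‖x‖ₑ) ^ q := by
            refine ENNReal.rpow_le_rpow ?_ hq0.le
            rw [← ofReal_norm, ← ofReal_norm, ← ENNReal.ofReal_mul hK.le]
            exact ENNReal.ofReal_le_ofReal (hb x A)
    simp only [G]
    rw [lintegral_const_mul' _ _ (ENNReal.rpow_ne_top_of_nonneg hq0.le ENNReal.ofNat_ne_top),
      lintegral_finsetSum' _ hmeas]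
    calc 2 ^ q * ∑ A ∈ F.powerset, ∫⁻ z, ‖∑ i ∈ A, a i • e i z‖ₑ ^ q
        ≤ 2 ^ q * ∑ A ∈ F.powerset, ENNReal.ofReal K ^ q * ‖x‖ₑ ^ q := by
          gcongr with A hA'
          exact hA A hA'
      _ = 2 ^ F.card * (2 ^ q * ENNReal.ofReal K ^ q * ‖x‖ₑ ^ q) := by
          rw [Finset.sum_const, Finset.card_powerset, nsmul_eq_mul]
          push_cast
          ring
  have hloc : ∀ i ∈ F, 2 ^ F.card * (c i.1 * ‖a i‖ₑ ^ q) ≤ ∫⁻ z in B i, G z := by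
    intro i hi
    calc 2 ^ F.card * (c i.1 * ‖a i‖ₑ ^ q)
        = ∫⁻ z in B i, 2 ^ F.card * ‖a i • e i z‖ₑ ^ q := by
          rw [lintegral_const_mul' _ _ (by finiteness)]
          simp_rw [enorm_smul, ENNReal.mul_rpow_of_nonneg _ _ hq0.le]
          rw [lintegral_const_mul' _ _ (by finiteness), mul_comm (c i.1)]
          simp only [B, e, translateSystem, setLIntegral_lpTranslate, c]
      _ ≤ ∫⁻ z in B i, G z := lintegral_mono fun z =>
          two_pow_card_mul_enorm_rpow_le (fun i => a i • e i z) hi hq1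
  -- The factor `n` counts the classes of disjoint balls; the number of subsets cancels.
  have hsum : ∑ i ∈ F, c i.1 * ‖a i‖ₑ ^ q
      ≤ n * (2 ^ q * ENNReal.ofReal K ^ q * ‖x‖ₑ ^ q) := by
    have h1 := (Finset.sum_le_sum hloc).trans
      (sum_setLIntegral_le_sum_lintegral F (fun i => i.1) hB hBd (fun _ => G))
    rw [← Finset.mul_sum, Finset.sum_const, Finset.card_univ, Fintype.card_fin, nsmul_eq_mul] at h1
    have h2 := h1.trans (mul_le_mul_right hG (n : ℝ≥0∞))
    rw [mul_left_comm] at h2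
    exact (ENNReal.mul_le_mul_iff_right (by positivity) (by finiteness)).1 h2
  calc ∑ i ∈ F, ‖a i‖ₑ ^ q
      ≤ ∑ i ∈ F, (∑ k, (c k)⁻¹) * (c i.1 * ‖a i‖ₑ ^ q) := by
        refine Finset.sum_le_sum fun i _ => ?_
        calc ‖a i‖ₑ ^ q = (c i.1)⁻¹ * (c i.1 * ‖a i‖ₑ ^ q) := by
              rw [← mul_assoc, ENNReal.inv_mul_cancel (hy i.1).ne' (hct i.1), one_mul]
          _ ≤ _ := by
              gcongr
              exact Finset.single_le_sum (f := fun k => (c k)⁻¹) (fun _ _ => zero_le)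
                (Finset.mem_univ i.1)
    _ = (∑ k, (c k)⁻¹) * ∑ i ∈ F, c i.1 * ‖a i‖ₑ ^ q := by rw [Finset.mul_sum]
    _ ≤ (∑ k, (c k)⁻¹) * (n * (2 ^ q * ENNReal.ofReal K ^ q * ‖x‖ₑ ^ q)) := by gcongr
    _ = _ := by ring

/-- The restrictions of separated translates to a small ball are `p`-summable. -/
theorem sum_enorm_restrict_ball_rpow_le (hp : p ≠ ∞) {δ : ℝ}
    (hsep : ∀ i j : Σ k, ι k, i ≠ j → i.1 = j.1 → δ ≤ dist (Γ i.1 i.2) (Γ j.1 j.2))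
    (F : Finset (Σ k, ι k)) :
    ∑ i ∈ F, ‖LpToLpRestrictCLM (EuclideanSpace ℝ (Fin d)) 𝕜 𝕜 volume p
      (Metric.ball 0 (δ / 2)) (translateSystem f Γ i)‖ₑ ^ p.toReal ≤ ∑ k, ‖f k‖ₑ ^ p.toReal := by
  have hp0 : p ≠ 0 := (one_pos.trans_le (Fact.out : (1 : ℝ≥0∞) ≤ p)).ne'
  -- The fixed ball translated back, so that `f k` is integrated over disjoint sets.
  let B : (Σ k, ι k) → Set (EuclideanSpace ℝ (Fin d)) := fun i =>
    (fun x => x + Γ i.1 i.2) ⁻¹' Metric.ball 0 (δ / 2)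
  have hB : ∀ i, MeasurableSet (B i) := fun i =>
    measurableSet_ball.preimage (measurable_id.add_const _)
  have hBd : ∀ i j, i ≠ j → i.1 = j.1 → Disjoint (B i) (B j) := by
    intro i j hij hk
    refine Set.disjoint_left.2 fun x hx hx' => (hsep i j hij hk).not_gt ?_
    simp only [B, Set.mem_preimage, Metric.mem_ball] at hx hx'
    have h1 := dist_triangle_right (x + Γ i.1 i.2) (x + Γ j.1 j.2) 0
    rw [dist_add_left] at h1
    linarith
  simp_rw [enorm_rpow_eq_lintegral hp0 hp (f _)]
  refine le_trans (le_of_eq (Finset.sum_congr rfl fun i _ => ?_))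
    (sum_setLIntegral_le_sum_lintegral F (fun i => i.1) hB hBd
      (fun k x => ‖f k x‖ₑ ^ p.toReal))
  rw [enorm_LpToLpRestrictCLM_rpow hp, ← setLIntegral_lpTranslate (Γ i.1 i.2) _ (f i.1)]
  congr 2
  ext x
  simp only [B, Set.mem_preimage, sub_add_cancel]

theorem sum_norm_rpow_le_of_sum_enorm_rpow_le {E ι : Type*} [NormedAddCommGroup E] {u : ι → E}
    {F : Finset ι} {q : ℝ} (hq : 0 ≤ q) {C : ℝ≥0∞} (hC : C ≠ ∞)
    (h : ∑ i ∈ F, ‖u i‖ₑ ^ q ≤ C) : ∑ i ∈ F, ‖u i‖ ^ q ≤ C.toReal := by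
  have h1 := ENNReal.toReal_mono hC h
  rw [ENNReal.toReal_sum fun i _ => ENNReal.rpow_ne_top_of_nonneg hq enorm_ne_top] at h1
  simpa [← ENNReal.toReal_rpow] using h1

theorem not_isUnconditionalBasis_translateSystem (hp2 : p ≤ 2) (hd : 1 ≤ d)
    (hf : ∀ k, f k ≠ 0) : ¬ IsUnconditionalBasis 𝕜 (translateSystem f Γ) := by
  intro h
  have hp : p ≠ ∞ := (hp2.trans_lt ENNReal.ofNat_lt_top).ne
  have hp1 : (1 : ℝ≥0∞) ≤ p := Fact.out
  have hq0 : 0 < p.toReal := ENNReal.toReal_pos (one_pos.trans_le hp1).ne' hp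
  have hq2 : p.toReal ≤ 2 := by
    simpa using ENNReal.toReal_mono ENNReal.ofNat_ne_top hp2
  obtain ⟨C, hC, hCa⟩ := h.exists_sum_enorm_coeff_rpow_le hp hf
  obtain ⟨δ, hδ, hsep⟩ := h.exists_separation hp hf
  have hroot : ∀ t : ℝ, 0 ≤ t → (t ^ p.toReal⁻¹) ^ p.toReal = t := fun t ht =>
    Real.rpow_inv_rpow ht hq0.ne'
  obtain ⟨A, hA⟩ := exists_finset_norm_le_half h.hasSum_coeff
    (LpToLpRestrictCLM (EuclideanSpace ℝ (Fin d)) 𝕜 𝕜 volume p (Metric.ball 0 (δ / 2)))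
    -- The `+ 1` keeps `D` positive.
    (q := p.toReal) (D := (C.toReal + 1) ^ p.toReal⁻¹)
    (D' := (∑ k, ‖f k‖ₑ ^ p.toReal).toReal ^ p.toReal⁻¹) hq0 hq2 (by positivity)
    (fun x F => by
      have h1 := sum_norm_rpow_le_of_sum_enorm_rpow_le hq0.le
        (ENNReal.mul_ne_top hC (ENNReal.rpow_ne_top_of_nonneg hq0.le enorm_ne_top)) (hCa x F)
      rw [ENNReal.toReal_mul, ← ENNReal.toReal_rpow, toReal_enorm] at h1
      rw [Real.mul_rpow (by positivity) (norm_nonneg _), hroot _ (by positivity)]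
      exact h1.trans (mul_le_mul_of_nonneg_right (by linarith) (by positivity)))
    (by positivity)
    (fun F => by
      rw [hroot _ ENNReal.toReal_nonneg]
      exact sum_norm_rpow_le_of_sum_enorm_rpow_le hq0.le
        (ENNReal.sum_ne_top.2 fun k _ => ENNReal.rpow_ne_top_of_nonneg hq0.le enorm_ne_top)
        (sum_enorm_restrict_ball_rpow_le hp hsep F))
  obtain ⟨x, hx0, hx, hxn⟩ := exists_ne_zero_norm_restrict_ball_eq hd (half_pos hδ)
    ((LinearMap.funLeft 𝕜 𝕜 (Subtype.val : A → Σ k, ι k)) ∘ₗ h.coeff)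
  have h1 := hA x fun i hi => congrFun hx ⟨i, hi⟩
  rw [hxn] at h1
  linarith [norm_pos_iff.2 hx0]

end TranslateSystem

theorem mainTheorem2 {𝕜 : Type*} [RCLike 𝕜] (p : ℝ≥0∞) [Fact (1 ≤ p)] (hp1 : 1 < p) (hp2 : p ≤ 2)
    (n d : ℕ) (hd : 1 ≤ d)
    (f : Fin n → Lp 𝕜 p (volume : Measure (EuclideanSpace ℝ (Fin d)))) (hf : ∀ k, f k ≠ 0)
    {ι : Fin n → Type*} (Γ : ∀ k, ι k → EuclideanSpace ℝ (Fin d)) :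
    (∀ M : Submodule 𝕜 (Lp 𝕜 p (volume : Measure (EuclideanSpace ℝ (Fin d)))),
      IsClosed (M : Set (Lp 𝕜 p (volume : Measure (EuclideanSpace ℝ (Fin d))))) →
      IsUnconditionalBasisOf M (translateSystem f Γ) → M ≠ ⊤) ∧
    ¬ IsUnconditionalBasis 𝕜 (translateSystem f Γ) := by
  have key : ¬ IsUnconditionalBasis 𝕜 (translateSystem f Γ) :=
    not_isUnconditionalBasis_translateSystem hp2 hd hf
  refine ⟨?_, key⟩
  rintro M - hM rfl
  exact key hM.isUnconditionalBasis
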